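/- All categories are enriched over the cartesian closed category $\mathbf{Pos}$ of posets and monotone maps: hom-sets carry a partial order and composition is monotone; functors are monotone on hom-sets, and equivalences are equivalences in this enriched sense. **Definitions.** Let $\mathcal K$ be such a category (with small hom-sets). * A *prekernel pair* (= subkernel pair) of $f\colon X\to Y$ is a pair $u_0,u_1\colon U\to X$ with $fu_0\le fu_1$ such that every pair $v_0,v_1\colon V\to X$ with $fv_0\le fv_1$ has the form $v_i=u_ik$ for some $k\colon V\to U$, and such that $u_ik\le u_i\bar k$ for $i=0,1$ implies $k\le\bar k$. * A *coinserter* of $u_0,u_1\colon U\to X$ is a morphism $f\colon X\to Y$ with $fu_0\le fu_1$ such that every $f'\colon X\to Y'$ with $f'u_0\le f'u_1$ has the form $f'=gf$, and such that $gf\le\bar gf$ implies $g\le\bar g$. It is *reflexive* if $u_0,u_1$ is a reflexive pair, i.e. there is $d\colon X\to U$ with $u_0d=u_1d=\mathrm{id}_X$. * A *tensor* $P\otimes G$ of an object $G$ by a poset $P$ is an object with order-isomorphisms $\mathbf{Pos}(P,\mathcal K(G,X))\cong\mathcal K(P\otimes G,X)$ natural in $X$; a monotone map $p\colon P\to Q$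 induces $p\otimes G\colon P\otimes G\to Q\otimes G$. * $G$ is *abstractly finite* if it has tensors $P\otimes G$ for all (small) posets $P$, and every morphism $G\to P\otimes G$ factorizes through $m\otimes G\colon Q\otimes G\to P\otimes G$ for some finite subposet $m\colon Q\hookrightarrow P$. * $G$ is a *subeffective projective* if $\mathcal K(G,-)\colon\mathcal K\to\mathbf{Pos}$ preserves reflexive coinserters. * $G$ is a *strong generator* if all copowers $\coprod_A G$ ($A$ a set) exist and every object $X$ is an extremal quotient of some copower: there is an epimorphism $e\colon\coprod_A G\to X$ which does not factorize through any proper subobject of $X$. Here epimorphisms and subobjects are meant in the enriched sense: $e$ is an epimorphism if $w_0e\le w_1e$ implies $w_0\le w_1$, and subobjects are represented by embeddings, i.e. morphisms $m$ for which $mw_0\le mw_1$ implies $w_0\le w_1$; thus an embedding through which $e$ factorizes is invertible. For a finitary signature $\Sigma=(\Sigma_n)_{n\in\mathbb N}$ of sets, an *ordered $\Sigma$-algebra* is a poset with a $\Sigma$-algebra structure whose operations are monotone; morphisms are the monotone homomorphisms, ordered pointwise. A *variety of ordered finitary algebras* is the full subcategory of ordered $\Sigma$-algebras specified by a set of inequations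 $s\le t$ between $\Sigma$-terms. **Theorem.** Let $\mathcal K$ be a $\mathbf{Pos}$-enriched category with prekernel pairs of all morphisms and coinserters of all reflexive pairs. Then $\mathcal K$ is equivalent to a variety of ordered finitary algebras if and only if $\mathcal K$ has a strong generator which is an abstractly finite subeffective projective. -/

import Mathlib

open CategoryTheory CategoryTheory.Limits

universe v u u₁ v₁

/-! ### Categories enriched over posets -/

/-- A category enriched over the cartesian closed category of posets: every hom-set carries a
partial order and composition is monotone. -/
class PosEnriched (C : Type u) [Category.{v} C] where
  homOrder (X Y : C) : PartialOrder (X ⟶ Y)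
  comp_mono {X Y Z : C} {f f' : X ⟶ Y} {g g' : Y ⟶ Z} :
    f ≤ f' → g ≤ g' → f ≫ g ≤ f' ≫ g'

namespace PosEnriched

instance instPartialOrderHom {C : Type u} [Category.{v} C] [PosEnriched C] (X Y : C) :
    PartialOrder (X ⟶ Y) := homOrder X Y

/-- Posets and monotone maps, with the pointwise order on hom-sets. -/
instance instPartOrd : PosEnriched PartOrd.{v} where
  homOrder X Y := PartialOrder.lift (fun f : X ⟶ Y => (f.hom : X →o Y))
    (fun _ _ h => PartOrd.hom_ext h)
  comp_mono {X Y Z f f' g g'} hf hg := fun x => by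
    have h1 : f.hom x ≤ f'.hom x := hf x
    have h2 : g.hom (f'.hom x) ≤ g'.hom (f'.hom x) := hg _
    exact le_trans (g.hom.monotone h1) h2

/-- A full subcategory of an enriched category, with the induced order on hom-sets. -/
instance instFullSubcategory {C : Type u} [Category.{v} C] [PosEnriched C]
    (P : ObjectProperty C) : PosEnriched P.FullSubcategory where
  homOrder X Y := PartialOrder.lift (fun f : X ⟶ Y => (f.hom : X.obj ⟶ Y.obj))
    (fun _ _ h => ObjectProperty.hom_ext P h)
  comp_mono {X Y Z f f' g g'} hf hg :=
    PosEnriched.comp_mono (f := f.hom) (f' := f'.hom) (g := g.hom) (g' := g'.hom) hf hg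

/-- A functor is enriched if it is monotone on hom-sets. -/
def IsLocallyMonotone {C : Type u} [Category.{v} C] [PosEnriched C]
    {D : Type u₁} [Category.{v₁} D] [PosEnriched D] (F : C ⥤ D) : Prop :=
  ∀ ⦃X Y : C⦄ (f g : X ⟶ Y), f ≤ g → F.map f ≤ F.map g

/-- Equivalence of enriched categories: an equivalence both of whose functors are enriched.
(Over posets, every natural transformation is enriched.) -/
def IsEquivalent (C : Type u) [Category.{v} C] [PosEnriched C]
    (D : Type u₁) [Category.{v₁} D] [PosEnriched D] : Prop :=
  ∃ e : C ≌ D, IsLocallyMonotone e.functor ∧ IsLocallyMonotone e.inverse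

section

variable {C : Type u} [Category.{v} C] [PosEnriched C]

/-- The enriched hom-functor `C(G, -)` with values in posets. -/
def homFunctor (G : C) : C ⥤ PartOrd.{v} where
  obj X := PartOrd.of (G ⟶ X)
  map {X Y} h := PartOrd.ofHom
    { toFun := fun f => f ≫ h
      monotone' := fun _ _ hf => comp_mono hf le_rfl }
  map_id X := by
    apply PartOrd.ext
    intro f
    exact Category.comp_id f
  map_comp h k := by
    apply PartOrd.ext
    intro f
    exact (Category.assoc f h k).symm

/-- `f` is a coinserter of the ordered pair `u₀, u₁`. -/
structure IsCoinserter {U X Y : C} (u₀ u₁ : U ⟶ X) (f : X ⟶ Y) : Prop where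
  condition : u₀ ≫ f ≤ u₁ ≫ f
  exists_desc : ∀ ⦃Z : C⦄ (f' : X ⟶ Z), u₀ ≫ f' ≤ u₁ ≫ f' → ∃ g : Y ⟶ Z, f ≫ g = f'
  le_of_comp_le : ∀ ⦃Z : C⦄ (g g' : Y ⟶ Z), f ≫ g ≤ f ≫ g' → g ≤ g'

/-- `u₀, u₁` is a prekernel pair (subkernel pair) of `f`. -/
structure IsPrekernelPair {U X Y : C} (u₀ u₁ : U ⟶ X) (f : X ⟶ Y) : Prop where
  condition : u₀ ≫ f ≤ u₁ ≫ f
  exists_lift : ∀ ⦃V : C⦄ (v₀ v₁ : V ⟶ X), v₀ ≫ f ≤ v₁ ≫ f →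
    ∃ k : V ⟶ U, k ≫ u₀ = v₀ ∧ k ≫ u₁ = v₁
  le_of_comp_le : ∀ ⦃V : C⦄ (k k' : V ⟶ U), k ≫ u₀ ≤ k' ≫ u₀ → k ≫ u₁ ≤ k' ≫ u₁ → k ≤ k'

variable (C) in
/-- Every morphism has a prekernel pair. -/
def HasPrekernelPairs : Prop :=
  ∀ ⦃X Y : C⦄ (f : X ⟶ Y), ∃ (U : C) (u₀ u₁ : U ⟶ X), IsPrekernelPair u₀ u₁ f

variable (C) in
/-- Every reflexive pair has a coinserter. -/
def HasReflexiveCoinserters : Prop :=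
  ∀ ⦃U X : C⦄ (u₀ u₁ : U ⟶ X), IsReflexivePair u₀ u₁ →
    ∃ (Y : C) (f : X ⟶ Y), IsCoinserter u₀ u₁ f

/-- A subeffective projective: the hom-functor into posets preserves coinserters of
reflexive pairs. -/
def IsSubeffectiveProjective (G : C) : Prop :=
  ∀ ⦃U X Y : C⦄ (u₀ u₁ : U ⟶ X) (f : X ⟶ Y), IsReflexivePair u₀ u₁ → IsCoinserter u₀ u₁ f →
    IsCoinserter ((homFunctor G).map u₀) ((homFunctor G).map u₁) ((homFunctor G).map f)

/-- A tensor `P ⊗ G` of the object `G` by the poset `P`: order isomorphisms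
`Pos(P, C(G, X)) ≅ C(P ⊗ G, X)`, natural in `X`. -/
structure Tensor (P : Type v) [PartialOrder P] (G : C) where
  obj : C
  homIso (X : C) : (P →o (G ⟶ X)) ≃o (obj ⟶ X)
  naturality : ∀ {X Y : C} (f : P →o (G ⟶ X)) (h : X ⟶ Y),
    homIso Y (((homFunctor G).map h).hom.comp f) = homIso X f ≫ h

/-- The unit `P → C(G, P ⊗ G)`, corresponding to the identity of `P ⊗ G`. -/
def Tensor.unit {P : Type v} [PartialOrder P] {G : C} (T : Tensor P G) : P →o (G ⟶ T.obj) :=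
  (T.homIso T.obj).symm (𝟙 T.obj)

/-- The morphism `p ⊗ G : P ⊗ G ⟶ Q ⊗ G` for a monotone map `p : P → Q`. -/
def Tensor.map {P Q : Type v} [PartialOrder P] [PartialOrder Q] {G : C}
    (T : Tensor P G) (T' : Tensor Q G) (p : P →o Q) : T.obj ⟶ T'.obj :=
  T.homIso T'.obj (T'.unit.comp p)

/-- `G` is abstractly finite: it has tensors by all posets, and every morphism `G ⟶ P ⊗ G`
factorizes through `m ⊗ G : Q ⊗ G ⟶ P ⊗ G` for some finite subposet `m : Q ↪ P`. -/
structure IsAbstractlyFinite (G : C) : Prop where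
  hasTensors : ∀ (P : Type v) [PartialOrder P], Nonempty (Tensor P G)
  exists_factor : ∀ (P : Type v) [PartialOrder P] (T : Tensor P G) (f : G ⟶ T.obj),
    ∃ Q : Set P, Q.Finite ∧ ∃ (T' : Tensor Q G) (g : G ⟶ T'.obj),
      g ≫ T'.map T (OrderHom.Subtype.val (· ∈ Q)) = f

/-- An embedding, i.e. a monomorphism in the enriched sense. Embeddings represent the
subobjects of their codomain. -/
def IsEmbedding {X Y : C} (m : X ⟶ Y) : Prop :=
  ∀ ⦃V : C⦄ (w₀ w₁ : V ⟶ X), w₀ ≫ m ≤ w₁ ≫ m → w₀ ≤ w₁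

/-- An epimorphism in the enriched sense. -/
def IsOrderEpi {X Y : C} (e : X ⟶ Y) : Prop :=
  ∀ ⦃Z : C⦄ (w₀ w₁ : Y ⟶ Z), e ≫ w₀ ≤ e ≫ w₁ → w₀ ≤ w₁

/-- An extremal epimorphism: an epimorphism that does not factorize through any proper
subobject. -/
structure IsExtremalQuotient {X Y : C} (e : X ⟶ Y) : Prop where
  epi : IsOrderEpi e
  isIso_of_fac : ∀ ⦃Z : C⦄ (p : X ⟶ Z) (m : Z ⟶ Y), IsEmbedding m → p ≫ m = e → IsIso m

/-- A strong generator: an object with copowers such that every object is an extremal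
quotient of a copower. -/
structure IsStrongGenerator (G : C) : Prop where
  hasCopowers : ∀ A : Type v, HasCoproduct (fun _ : A => G)
  exists_quotient : ∀ X : C, ∃ (A : Type v) (c : Cofan (fun _ : A => G)) (e : c.pt ⟶ X),
    Nonempty (IsColimit c) ∧ IsExtremalQuotient e

end

end PosEnriched

/-! ### Ordered algebras and their varieties -/

/-- A finitary signature `S` (with `S n` the set of `n`-ary operation symbols) gives ordered
algebras: posets with monotone operations. -/
structure OrdAlg (S : ℕ → Type v) where
  carrier : Type v
  [order : PartialOrder carrier]
  op : ∀ {n : ℕ}, S n → (Fin n → carrier) → carrier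
  op_mono : ∀ {n : ℕ} (σ : S n), Monotone (op σ)

namespace OrdAlg

attribute [instance] OrdAlg.order

variable {S : ℕ → Type v}

/-- Monotone homomorphisms. -/
@[ext]
structure Hom (A B : OrdAlg S) where
  toOrderHom : A.carrier →o B.carrier
  map_op : ∀ {n : ℕ} (σ : S n) (x : Fin n → A.carrier),
    toOrderHom (A.op σ x) = B.op σ (fun i => toOrderHom (x i))

/-- The category of ordered algebras and monotone homomorphisms. -/
instance instCategory : Category.{v} (OrdAlg S) where
  Hom A B := Hom A B
  id A := { toOrderHom := OrderHom.id, map_op := fun _ _ => rfl }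
  comp f g :=
    { toOrderHom := g.toOrderHom.comp f.toOrderHom
      map_op := fun σ x => by
        simp only [OrderHom.comp_coe, Function.comp_apply, f.map_op, g.map_op] }

/-- Homomorphisms are ordered pointwise. -/
instance instPosEnriched : PosEnriched (OrdAlg S) where
  homOrder A B := PartialOrder.lift (fun f : A ⟶ B => Hom.toOrderHom f)
    (fun _ _ h => Hom.ext h)
  comp_mono {A B D f f' g g'} hf hg := fun x => by
    have h1 : f.toOrderHom x ≤ f'.toOrderHom x := hf x
    have h2 : g.toOrderHom (f'.toOrderHom x) ≤ g'.toOrderHom (f'.toOrderHom x) := hg _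
    exact le_trans (g.toOrderHom.monotone h1) h2

end OrdAlg

/-- Terms over the signature `S` in the variables `x₀, x₁, x₂, …`. -/
inductive OrdTerm (S : ℕ → Type v) : Type v
  | var : ℕ → OrdTerm S
  | app : {n : ℕ} → S n → (Fin n → OrdTerm S) → OrdTerm S

/-- The value of a term in an algebra under an assignment of the variables. -/
def OrdTerm.eval {S : ℕ → Type v} (A : OrdAlg S) (a : ℕ → A.carrier) : OrdTerm S → A.carrier
  | .var i => a i
  | .app σ t => A.op σ (fun i => (t i).eval A a)

/-- `A` satisfies all inequations `s ≤ t` with `(s, t)` in `E`. -/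
def OrdAlg.Satisfies {S : ℕ → Type v} (E : Set (OrdTerm S × OrdTerm S)) :
    ObjectProperty (OrdAlg S) :=
  fun A => ∀ p ∈ E, ∀ a : ℕ → A.carrier, p.1.eval A a ≤ p.2.eval A a

/-- The variety of ordered `S`-algebras presented by the set `E` of inequations, as a full
subcategory of the category of ordered `S`-algebras. -/
abbrev OrdVariety (S : ℕ → Type v) (E : Set (OrdTerm S × OrdTerm S)) : Type (v + 1) :=
  (OrdAlg.Satisfies E).FullSubcategory

/-!
The theorem rests on comparing an object `X` with the poset of morphisms `G ⟶ X`.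

Given a variety, `G` corresponds to the free algebra on one generator, so that `G ⟶ X` is the
underlying poset of `X`. The free algebra on a poset `P` is the tensor `P ⊗ G`
(`FreeOn.tensor`); terms have finitely many variables, which gives abstract finiteness
(`FreeOn.isAbstractlyFinite`); every algebra is a quotient of the free algebra on its elements
(`FreeOn.isStrongGenerator`). For a reflexive pair of homomorphisms, the generated preorder on the
codomain is compatible with the operations, so coinserters are computed on underlying posets
(`IsCoinserter.surjective_and_reflTransGen`), which gives projectivity.

Conversely, given `G`, let the `n`-ary operation symbols be the morphisms from `G` to its `n`-th
copower. They act on `G ⟶ X` by precomposition, and `nerve` sends `X` to this algebra, in the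
variety of all inequations valid in all these algebras. Every object is the coinserter of the
prekernel pair of its canonical quotient `∐ G ⟶ X` (`exists_isCoinserter_canonicalQuotient`), and
the algebra of a copower is generated by the coprojections because `G` is abstractly finite
(`IsAbstractlyFinite.exists_genTerm`); together these make `nerve` full and order reflecting. The
algebra of a copower is moreover free in the variety (`exists_hom_of_copower`), since an inequation
between terms in the coprojections is valid everywhere. Hence any algebra `B` of the variety is a
quotient of the algebra of a copower `F`, and the coinserter in the category of the pair of
morphisms to `F` indexed by the induced preorder is mapped to `B`, because `G` is projective
(`nerve_essSurj`).
-/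

/-! ### Enriched categories, tensors and copowers -/

/-- A set regarded as a discrete poset. -/
def DiscretePoset (A : Type v) : Type v := A

namespace DiscretePoset

instance (A : Type v) : PartialOrder (DiscretePoset A) where
  le a b := a = b
  le_refl _ := rfl
  le_trans _ _ _ := Eq.trans
  le_antisymm _ _ h _ := h

/-- Every function on a set is a monotone map on the corresponding discrete poset. -/
def lift {A : Type v} {P : Type*} [Preorder P] (f : A → P) : DiscretePoset A →o P where
  toFun := f
  monotone' _ _ h := (congrArg f h).le

end DiscretePoset

namespace PosEnriched

section

variable {C : Type u} [Category.{v} C] [PosEnriched C]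

lemma comp_le_comp_left {X Y Z : C} (f : X ⟶ Y) {g g' : Y ⟶ Z} (h : g ≤ g') :
    f ≫ g ≤ f ≫ g' := comp_mono le_rfl h

lemma comp_le_comp_right {X Y Z : C} {f f' : X ⟶ Y} (h : f ≤ f') (g : Y ⟶ Z) :
    f ≫ g ≤ f' ≫ g := comp_mono h le_rfl

/-- The functor of an enriched equivalence reflects the order of morphisms. -/
lemma IsLocallyMonotone.le_of_map_le {D : Type u₁} [Category.{v₁} D] [PosEnriched D]
    {e : C ≌ D} (h : IsLocallyMonotone e.inverse) {X Y : C} {f g : X ⟶ Y}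
    (hfg : e.functor.map f ≤ e.functor.map g) : f ≤ g := by
  have key (k : X ⟶ Y) :
      k = e.unit.app X ≫ e.inverse.map (e.functor.map k) ≫ e.unitInv.app Y := by simp
  rw [key f, key g]
  exact comp_le_comp_left _ (comp_le_comp_right (h _ _ hfg) _)

/-- An equivalence that is monotone and order reflecting on hom-sets is an equivalence of
enriched categories. -/
lemma IsEquivalent.of_functor {D : Type u₁} [Category.{v₁} D] [PosEnriched D]
    (F : C ⥤ D) [F.IsEquivalence] (hF : IsLocallyMonotone F)
    (hF' : ∀ ⦃X Y : C⦄ (f g : X ⟶ Y), F.map f ≤ F.map g → f ≤ g) : IsEquivalent C D := by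
  refine ⟨F.asEquivalence, hF, fun X Y f g hfg => hF' _ _ ?_⟩
  have key (k : X ⟶ Y) : F.map (F.asEquivalence.inverse.map k) =
      F.asEquivalence.counit.app X ≫ k ≫ F.asEquivalence.counitInv.app Y :=
    F.asEquivalence.fun_inv_map _ _ k
  rw [key f, key g]
  exact comp_le_comp_left _ (comp_le_comp_right hfg _)

namespace Tensor

variable {P Q R : Type v} [PartialOrder P] [PartialOrder Q] [PartialOrder R] {G : C}

lemma homIso_unit_comp (T : Tensor P G) {X : C} (g : T.obj ⟶ X) :
    T.homIso X (((homFunctor G).map g).hom.comp T.unit) = g := by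
  rw [T.naturality, Tensor.unit, OrderIso.apply_symm_apply, Category.id_comp]

lemma unit_homIso (T : Tensor P G) {X : C} (f : P →o (G ⟶ X)) (p : P) :
    T.unit p ≫ T.homIso X f = f p :=
  congrArg (fun k : P →o (G ⟶ X) => k p)
    ((T.homIso X).injective (T.homIso_unit_comp (T.homIso X f)))

lemma hom_le (T : Tensor P G) {X : C} {g g' : T.obj ⟶ X}
    (h : ∀ p, T.unit p ≫ g ≤ T.unit p ≫ g') : g ≤ g' := by
  rw [← T.homIso_unit_comp g, ← T.homIso_unit_comp g']
  exact (T.homIso X).monotone h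

lemma hom_ext (T : Tensor P G) {X : C} {g g' : T.obj ⟶ X}
    (h : ∀ p, T.unit p ≫ g = T.unit p ≫ g') : g = g' :=
  le_antisymm (T.hom_le fun p => (h p).le) (T.hom_le fun p => (h p).ge)

lemma unit_map (T : Tensor P G) (T' : Tensor Q G) (m : P →o Q) (p : P) :
    T.unit p ≫ T.map T' m = T'.unit (m p) :=
  T.unit_homIso _ p

lemma map_comp_map (T : Tensor P G) (T' : Tensor Q G) (T'' : Tensor R G) (m : P →o Q)
    (m' : Q →o R) : T.map T' m ≫ T'.map T'' m' = T.map T'' (m'.comp m) :=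
  T.hom_ext fun p => by
    rw [← Category.assoc, unit_map, unit_map, unit_map, OrderHom.comp_coe, Function.comp_apply]

lemma map_id (T : Tensor P G) : T.map T OrderHom.id = 𝟙 _ :=
  T.hom_ext fun p => by rw [unit_map, Category.comp_id, OrderHom.id_coe, id]

/-- The morphism from a copower given by a family of morphisms. -/
def desc {A : Type v} (T : Tensor (DiscretePoset A) G) {X : C} (f : A → (G ⟶ X)) : T.obj ⟶ X :=
  T.homIso X (DiscretePoset.lift f)

/-- The coprojections of a copower. -/
def ι {A : Type v} (T : Tensor (DiscretePoset A) G) (a : A) : G ⟶ T.obj :=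
  T.unit (P := DiscretePoset A) a

section Copower

variable {A : Type v} (T : Tensor (DiscretePoset A) G) {X : C}

lemma ι_desc (f : A → (G ⟶ X)) (a : A) : T.ι a ≫ T.desc f = f a :=
  T.unit_homIso (DiscretePoset.lift f) a

lemma copower_hom_le {g g' : T.obj ⟶ X} (h : ∀ a, T.ι a ≫ g ≤ T.ι a ≫ g') : g ≤ g' :=
  T.hom_le h

lemma copower_hom_ext {g g' : T.obj ⟶ X} (h : ∀ a, T.ι a ≫ g = T.ι a ≫ g') : g = g' :=
  T.hom_ext h

lemma desc_comp {Y : C} (f : A → (G ⟶ X)) (g : X ⟶ Y) :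
    T.desc f ≫ g = T.desc fun a => f a ≫ g :=
  T.copower_hom_ext fun a => by rw [← Category.assoc, ι_desc, ι_desc]

lemma desc_mono {f f' : A → (G ⟶ X)} (h : f ≤ f') : T.desc f ≤ T.desc f' :=
  T.copower_hom_le fun a => by rw [ι_desc, ι_desc]; exact h a

/-- A tensor by a discrete poset is a coproduct. -/
def isColimitCofan : IsColimit (Cofan.mk T.obj T.ι) :=
  Cofan.IsColimit.mk _ (fun s => T.desc s.inj) (fun s a => T.ι_desc s.inj a)
    (fun s m h => T.copower_hom_ext fun a => by rw [ι_desc]; exact h a)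

end Copower

end Tensor

end

end PosEnriched

/-! ### Terms over a set of generators -/

/-- Terms over the signature `S` whose variables are the elements of `P`. -/
inductive GenTerm (S : ℕ → Type v) (P : Type v) : Type v
  | var : P → GenTerm S P
  | app : {n : ℕ} → S n → (Fin n → GenTerm S P) → GenTerm S P

namespace GenTerm

variable {S : ℕ → Type v} {P Q : Type v}

/-- The value of a term in an algebra under an assignment of its variables. -/
def eval (A : OrdAlg S) (a : P → A.carrier) : GenTerm S P → A.carrier
  | var p => a p
  | app σ t => A.op σ fun i => (t i).eval A a

/-- Substitution of numbered variables for the generators. -/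
def toOrdTerm (c : P → ℕ) : GenTerm S P → OrdTerm S
  | var p => .var (c p)
  | app σ t => .app σ fun i => (t i).toOrdTerm c

/-- The generators occurring in a term. -/
def vars : GenTerm S P → Set P
  | var p => {p}
  | app _ t => ⋃ i, (t i).vars

lemma finite_vars (t : GenTerm S P) : t.vars.Finite := by
  induction t with
  | var p => exact Set.finite_singleton p
  | app σ t ih => exact Set.finite_iUnion ih

lemma eval_toOrdTerm (A : OrdAlg S) (a : ℕ → A.carrier) (c : P → ℕ) (t : GenTerm S P) :
    (t.toOrdTerm c).eval A a = t.eval A (fun p => a (c p)) := by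
  induction t with
  | var p => rfl
  | app σ t ih => exact congrArg (A.op σ) (funext ih)

lemma eval_congr (A : OrdAlg S) {a b : P → A.carrier} (t : GenTerm S P)
    (h : ∀ p ∈ t.vars, a p = b p) : t.eval A a = t.eval A b := by
  induction t with
  | var p => exact h p rfl
  | app σ t ih =>
    exact congrArg (A.op σ) (funext fun i => ih i fun p hp => h p (Set.mem_iUnion_of_mem i hp))

lemma eval_mono (A : OrdAlg S) {a b : P → A.carrier} (h : a ≤ b) (t : GenTerm S P) :
    t.eval A a ≤ t.eval A b := by
  induction t with
  | var p => exact h p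
  | app σ t ih => exact A.op_mono σ ih

/-- A term is the image of a term over any set of generators containing its variables. -/
lemma exists_restrict (t : GenTerm S P) {D : Set P} (h : t.vars ⊆ D) :
    ∃ t' : GenTerm S D, ∀ (A : OrdAlg S) (a : P → A.carrier),
      t'.eval A (fun d : D => a d) = t.eval A a := by
  induction t with
  | var p => exact ⟨var ⟨p, h rfl⟩, fun _ _ => rfl⟩
  | app σ t ih =>
    choose t' ht' using fun i => ih i ((Set.subset_iUnion _ i).trans h)
    exact ⟨app σ t', fun A a => congrArg (A.op σ) (funext fun i => ht' i A a)⟩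

end GenTerm

namespace OrdAlg

variable {S : ℕ → Type v}

lemma Hom.map_genEval {P : Type v} {A B : OrdAlg S} (f : A ⟶ B) (a : P → A.carrier)
    (t : GenTerm S P) :
    f.toOrderHom (t.eval A a) = t.eval B fun p => f.toOrderHom (a p) := by
  induction t with
  | var p => rfl
  | app σ t ih => exact (f.map_op σ _).trans (congrArg (B.op σ) (funext ih))

lemma Hom.map_eval {A B : OrdAlg S} (f : A ⟶ B) (a : ℕ → A.carrier) (t : OrdTerm S) :
    f.toOrderHom (t.eval A a) = t.eval B fun p => f.toOrderHom (a p) := by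
  induction t with
  | var p => rfl
  | app σ t ih => exact (f.map_op σ _).trans (congrArg (B.op σ) (funext ih))

/-- An inequation between terms over an arbitrary set holds in an algebra satisfying `E` as soon
as all its instances with numbered variables belong to `E`: only finitely many generators occur,
and numbering these can be undone. -/
lemma Satisfies.eval_le {E : Set (OrdTerm S × OrdTerm S)} {B : OrdAlg S} (hB : Satisfies E B)
    {P : Type v} (s t : GenTerm S P) (h : ∀ c : P → ℕ, (s.toOrdTerm c, t.toOrdTerm c) ∈ E)
    (b : P → B.carrier) : s.eval B b ≤ t.eval B b := by
  obtain ⟨c, hc⟩ := Set.countable_iff_exists_injOn.1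
    (s.finite_vars.union t.finite_vars).countable
  -- Numbers not used for a variable get the value of `s`, as `B` has no other element at hand.
  let a : ℕ → B.carrier := fun k => by
    classical
    exact if h : ∃ p ∈ s.vars ∪ t.vars, c p = k then b h.choose else s.eval B b
  have ha : ∀ p ∈ s.vars ∪ t.vars, a (c p) = b p := fun p hp => by
    have h : ∃ q ∈ s.vars ∪ t.vars, c q = c p := ⟨p, hp, rfl⟩
    simp only [a, dif_pos h]
    exact congrArg b (hc h.choose_spec.1 hp h.choose_spec.2)
  have key := hB _ (h c) a
  rw [GenTerm.eval_toOrdTerm, GenTerm.eval_toOrdTerm] at key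
  rwa [s.eval_congr B fun p hp => ha p (Or.inl hp),
    t.eval_congr B fun p hp => ha p (Or.inr hp)] at key

end OrdAlg

namespace OrdVariety

variable {S : ℕ → Type v} {E : Set (OrdTerm S × OrdTerm S)}

lemma isIso_of_surjective {A B : OrdVariety S E} (f : A ⟶ B)
    (hs : Function.Surjective f.hom.toOrderHom)
    (hf : ∀ x y, f.hom.toOrderHom x ≤ f.hom.toOrderHom y → x ≤ y) : IsIso f := by
  have hi : Function.Injective f.hom.toOrderHom := fun x y h =>
    le_antisymm (hf _ _ h.le) (hf _ _ h.ge)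
  let g : B.obj ⟶ A.obj :=
    { toOrderHom := ⟨Function.surjInv hs, fun x y h => hf _ _ (by
        rwa [Function.surjInv_eq hs, Function.surjInv_eq hs])⟩
      map_op := fun σ x => hi (by
        refine (Function.surjInv_eq hs _).trans ((f.hom.map_op σ _).trans ?_).symm
        exact congrArg (B.obj.op σ) (funext fun i => Function.surjInv_eq hs (x i))) }
  refine ⟨ObjectProperty.homMk g, ?_, ?_⟩
  · refine ObjectProperty.hom_ext _ (OrdAlg.Hom.ext (OrderHom.ext _ _ (funext fun x => ?_)))
    exact hi (Function.surjInv_eq hs _)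
  · refine ObjectProperty.hom_ext _ (OrdAlg.Hom.ext (OrderHom.ext _ _ (funext fun x => ?_)))
    exact Function.surjInv_eq hs x

end OrdVariety

namespace PosEnriched

/-! ### Coinserters and projectivity -/

/-- A coinserter in the category of posets is surjective, since it factorizes through its image. -/
lemma IsCoinserter.surjective {U X Y : PartOrd.{v}} {u₀ u₁ : U ⟶ X} {f : X ⟶ Y}
    (hf : IsCoinserter u₀ u₁ f) : Function.Surjective f := by
  let I : PartOrd.{v} := PartOrd.of (Set.range f)
  let p : X ⟶ I := PartOrd.ofHom
    ⟨fun x => ⟨f x, x, rfl⟩, fun _ _ h => f.hom.monotone h⟩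
  let m : I ⟶ Y := PartOrd.ofHom ⟨Subtype.val, fun _ _ h => h⟩
  obtain ⟨g, hg⟩ := hf.exists_desc p (fun x => hf.condition x)
  have hpm : f ≫ g ≫ m = f ≫ 𝟙 Y := by rw [← Category.assoc, hg, Category.comp_id]; rfl
  have hgm : g ≫ m = 𝟙 Y :=
    le_antisymm (hf.le_of_comp_le _ _ hpm.le) (hf.le_of_comp_le _ _ hpm.ge)
  intro y
  obtain ⟨x, hx⟩ := (g y).2
  exact ⟨x, hx.trans (congrArg (fun k : Y ⟶ Y => k y) hgm)⟩

section

variable {C : Type u} [Category.{v} C] [PosEnriched C] {G : C}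

lemma IsCoinserter.comp_isIso {U X Y Z : C} {u₀ u₁ : U ⟶ X} {f : X ⟶ Y}
    (hf : IsCoinserter u₀ u₁ f) (m : Y ⟶ Z) [IsIso m] : IsCoinserter u₀ u₁ (f ≫ m) where
  condition := by
    rw [← Category.assoc, ← Category.assoc]
    exact comp_le_comp_right hf.condition m
  exists_desc W f' h := by
    obtain ⟨g, hg⟩ := hf.exists_desc f' h
    exact ⟨inv m ≫ g, by simpa using hg⟩
  le_of_comp_le W g g' h := by
    rw [Category.assoc, Category.assoc] at h
    have := comp_le_comp_left (inv m) (hf.le_of_comp_le _ _ h)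
    rwa [IsIso.inv_hom_id_assoc, IsIso.inv_hom_id_assoc] at this

lemma IsSubeffectiveProjective.exists_lift (hG : IsSubeffectiveProjective G) {U X Y : C}
    {u₀ u₁ : U ⟶ X} {f : X ⟶ Y} (hu : IsReflexivePair u₀ u₁) (hf : IsCoinserter u₀ u₁ f)
    (y : G ⟶ Y) : ∃ x : G ⟶ X, x ≫ f = y :=
  (hG u₀ u₁ f hu hf).surjective y

lemma IsPrekernelPair.isReflexivePair {U X Y : C} {u₀ u₁ : U ⟶ X} {f : X ⟶ Y}
    (h : IsPrekernelPair u₀ u₁ f) : IsReflexivePair u₀ u₁ := by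
  obtain ⟨d, h₀, h₁⟩ := h.exists_lift (𝟙 X) (𝟙 X) le_rfl
  exact ⟨d, h₀, h₁⟩

/-! ### The canonical presentation of an object -/

section Presentation

variable (T : ∀ A : Type v, Tensor (DiscretePoset A) G)

/-- The canonical morphism to `X` from the copower of `G` indexed by `G ⟶ X`. -/
def canonicalQuotient (X : C) : (T (G ⟶ X)).obj ⟶ X := (T (G ⟶ X)).desc id

lemma ι_canonicalQuotient {X : C} (x : G ⟶ X) :
    (T (G ⟶ X)).ι x ≫ canonicalQuotient T X = x :=
  (T (G ⟶ X)).ι_desc id x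

/-- Every morphism from a copower to `X` factorizes through the canonical one, so the latter is an
extremal quotient as soon as `X` is an extremal quotient of some copower. -/
lemma IsStrongGenerator.isExtremalQuotient_canonicalQuotient (hG : IsStrongGenerator G) (X : C) :
    IsExtremalQuotient (canonicalQuotient T X) := by
  obtain ⟨A, c, e, ⟨hc⟩, he⟩ := hG.exists_quotient X
  obtain ⟨k, hk⟩ : ∃ k : c.pt ⟶ (T (G ⟶ X)).obj, k ≫ canonicalQuotient T X = e := by
    refine ⟨Cofan.IsColimit.desc hc fun a => (T (G ⟶ X)).ι (c.inj a ≫ e), ?_⟩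
    refine Cofan.IsColimit.hom_ext hc _ _ fun a => ?_
    rw [← Category.assoc, Cofan.IsColimit.fac, ι_canonicalQuotient]
  refine ⟨fun Z w₀ w₁ h => he.epi _ _ ?_, fun Z p m hm hpm => he.isIso_of_fac (k ≫ p) m hm ?_⟩
  · rw [← hk, Category.assoc, Category.assoc]
    exact comp_le_comp_left k h
  · rw [Category.assoc, hpm, hk]

include T in
/-- Morphisms out of a strong generator detect the order of parallel morphisms. -/
lemma IsStrongGenerator.le_of_forall_le (hG : IsStrongGenerator G) {X Y : C} {g g' : X ⟶ Y}
    (h : ∀ x : G ⟶ X, x ≫ g ≤ x ≫ g') : g ≤ g' := by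
  refine (hG.isExtremalQuotient_canonicalQuotient T X).epi _ _ ?_
  refine (T _).copower_hom_le fun x => ?_
  rw [← Category.assoc, ← Category.assoc, ι_canonicalQuotient]
  exact h x

/-- The canonical quotient is the coinserter of its prekernel pair: the comparison morphism from
the coinserter is an embedding by projectivity, hence invertible by extremality. -/
lemma exists_isCoinserter_canonicalQuotient (hker : HasPrekernelPairs C)
    (hcoins : HasReflexiveCoinserters C) (hG : IsStrongGenerator G)
    (hproj : IsSubeffectiveProjective G) (X : C) :
    ∃ (U : C) (u₀ u₁ : U ⟶ (T (G ⟶ X)).obj), IsReflexivePair u₀ u₁ ∧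
      IsPrekernelPair u₀ u₁ (canonicalQuotient T X) ∧
      IsCoinserter u₀ u₁ (canonicalQuotient T X) := by
  obtain ⟨U, u₀, u₁, hu⟩ := hker (canonicalQuotient T X)
  obtain ⟨Z, c, hc⟩ := hcoins u₀ u₁ hu.isReflexivePair
  obtain ⟨m, hm⟩ := hc.exists_desc _ hu.condition
  refine ⟨U, u₀, u₁, hu.isReflexivePair, hu, ?_⟩
  have hemb : IsEmbedding m := fun V w₀ w₁ hw => hG.le_of_forall_le T fun x => by
    obtain ⟨y₀, hy₀⟩ := hproj.exists_lift hu.isReflexivePair hc (x ≫ w₀)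
    obtain ⟨y₁, hy₁⟩ := hproj.exists_lift hu.isReflexivePair hc (x ≫ w₁)
    obtain ⟨k, hk₀, hk₁⟩ := hu.exists_lift y₀ y₁ (by
      rw [← hm, ← Category.assoc, ← Category.assoc, hy₀, hy₁, Category.assoc, Category.assoc]
      exact comp_le_comp_left x hw)
    rw [← hy₀, ← hy₁, ← hk₀, ← hk₁, Category.assoc, Category.assoc]
    exact comp_le_comp_left k hc.condition
  have := (hG.isExtremalQuotient_canonicalQuotient T X).isIso_of_fac c m hemb hm
  rw [← hm]
  exact hc.comp_isIso m

end Presentation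

/-! ### The algebras of generalized elements -/

section Nerve

variable (T : ∀ A : Type v, Tensor (DiscretePoset A) G)

/-- The signature whose `n`-ary operations are the morphisms from `G` to its `n`-th copower. -/
def nerveSig (n : ℕ) : Type v := G ⟶ (T (ULift.{v} (Fin n))).obj

/-- The algebra of morphisms `G ⟶ X`, on which an operation symbol acts by precomposition. -/
def nerveAlg (X : C) : OrdAlg (nerveSig T) where
  carrier := G ⟶ X
  op {n} σ x := CategoryStruct.comp (obj := C) (X := G) σ
    ((T (ULift.{v} (Fin n))).desc fun i => x i.down)
  op_mono _ _ _ h := comp_le_comp_left _ ((T _).desc_mono fun i => h i.down)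

/-- The homomorphism of algebras given by postcomposition. -/
def nerveMap {X Y : C} (g : X ⟶ Y) : nerveAlg T X ⟶ nerveAlg T Y where
  toOrderHom := ⟨fun x : G ⟶ X => x ≫ g, fun _ _ h => comp_le_comp_right h g⟩
  map_op _ _ := (Category.assoc _ _ _).trans (congrArg (_ ≫ ·) ((T _).desc_comp _ g))

/-- The inequations valid in all algebras `G ⟶ X`. -/
def nerveIneqs : Set (OrdTerm (nerveSig T) × OrdTerm (nerveSig T)) :=
  {p | ∀ (X : C) (a : ℕ → (nerveAlg T X).carrier),
    p.1.eval (nerveAlg T X) a ≤ p.2.eval (nerveAlg T X) a}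

/-- The functor `C(G, -)` with values in the variety of all valid inequations. -/
def nerve : C ⥤ OrdVariety (nerveSig T) (nerveIneqs T) where
  obj X := ⟨nerveAlg T X, fun _ hp => hp X⟩
  map g := ObjectProperty.homMk (nerveMap T g)
  map_id _ := ObjectProperty.hom_ext _ (OrdAlg.Hom.ext (OrderHom.ext _ _ (funext fun x =>
    Category.comp_id (X := G) x)))
  map_comp f g := ObjectProperty.hom_ext _ (OrdAlg.Hom.ext (OrderHom.ext _ _ (funext fun x =>
    (Category.assoc (W := G) x f g).symm)))

/-- By abstract finiteness, the algebra of a copower is generated by the coprojections. -/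
lemma IsAbstractlyFinite.exists_genTerm (hG : IsAbstractlyFinite G) {A : Type v}
    (s : G ⟶ (T A).obj) :
    ∃ t : GenTerm (nerveSig T) A, t.eval (nerveAlg T (T A).obj) (T A).ι = s := by
  obtain ⟨Q, hQ, T', g, rfl⟩ := hG.exists_factor (DiscretePoset A) (T A) s
  have : Finite Q := hQ
  obtain ⟨n, ⟨e⟩⟩ := Finite.exists_equiv_fin Q
  -- The subposet is discrete, so it may be replaced by the discrete poset on `Fin n`.
  let m : Q →o DiscretePoset (ULift.{v} (Fin n)) :=
    ⟨fun q => ULift.up (e q), fun q q' h => congrArg (fun q => ULift.up (e q)) (Subtype.ext h)⟩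
  refine ⟨.app (n := n) (g ≫ T'.map (T _) m) fun i => .var (e.symm i).1, ?_⟩
  refine (Category.assoc _ _ _).trans (congrArg (g ≫ ·) (T'.hom_ext fun q => ?_))
  rw [← Category.assoc, Tensor.unit_map, Tensor.unit_map]
  refine ((T _).ι_desc _ _).trans ?_
  exact congrArg (fun q : Q => (T A).ι q.1) (e.symm_apply_apply q)

lemma nerve_map_le_iff (hG : IsStrongGenerator G) {X Y : C} (f g : X ⟶ Y) :
    (nerve T).map f ≤ (nerve T).map g ↔ f ≤ g :=
  ⟨fun h => hG.le_of_forall_le T fun x => h x, fun h x => comp_le_comp_left (X := G) x h⟩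

/-- A homomorphism is determined by its composite with the canonical quotient, which it carries
along because the algebra of a copower is generated by the coprojections. -/
lemma nerve_full (hker : HasPrekernelPairs C) (hcoins : HasReflexiveCoinserters C)
    (hG : IsStrongGenerator G) (hfin : IsAbstractlyFinite G)
    (hproj : IsSubeffectiveProjective G) : (nerve T).Full where
  map_surjective {X Y} h := by
    let f : (T (G ⟶ X)).obj ⟶ Y := (T (G ⟶ X)).desc h.hom.toOrderHom
    have hf (s : G ⟶ (T (G ⟶ X)).obj) :
        s ≫ f = h.hom.toOrderHom (s ≫ canonicalQuotient T X) := by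
      obtain ⟨t, rfl⟩ := hfin.exists_genTerm T s
      have h₁ := OrdAlg.Hom.map_genEval (nerveMap T f) (T (G ⟶ X)).ι t
      have h₂ := OrdAlg.Hom.map_genEval (nerveMap T (canonicalQuotient T X)) (T (G ⟶ X)).ι t
      refine h₁.trans (Eq.trans ?_ (congrArg h.hom.toOrderHom h₂).symm)
      refine Eq.trans ?_ (h.hom.map_genEval _ t).symm
      refine congrArg (fun a => t.eval (nerveAlg T Y) a) (funext fun x => ?_)
      exact ((T _).ι_desc _ x).trans (congrArg h.hom.toOrderHom (ι_canonicalQuotient T x).symm)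
    obtain ⟨U, u₀, u₁, hu, -, hc⟩ :=
      exists_isCoinserter_canonicalQuotient T hker hcoins hG hproj X
    obtain ⟨g, hg⟩ := hc.exists_desc f (hG.le_of_forall_le T fun x => by
      rw [← Category.assoc, ← Category.assoc, hf, hf, Category.assoc, Category.assoc]
      exact h.hom.toOrderHom.monotone (comp_le_comp_left x hc.condition))
    refine ⟨g, ObjectProperty.hom_ext _ (OrdAlg.Hom.ext (OrderHom.ext _ _ (funext fun x => ?_)))⟩
    obtain ⟨s, rfl⟩ := hproj.exists_lift hu hc x
    exact (Category.assoc s _ g).trans ((congrArg (s ≫ ·) hg).trans (hf s))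

/-- The algebra of a copower is free: every map from the index set to an algebra `B` in the
variety extends to a homomorphism. -/
lemma exists_hom_of_copower (hfin : IsAbstractlyFinite G)
    (B : OrdVariety (nerveSig T) (nerveIneqs T)) {A : Type v} (b : A → B.obj.carrier) :
    ∃ φ : nerveAlg T (T A).obj ⟶ B.obj, ∀ a, φ.toOrderHom ((T A).ι a) = b a := by
  choose t ht using fun s : G ⟶ (T A).obj => hfin.exists_genTerm T s
  -- An inequation between terms in the coprojections holds under every assignment.
  have key (p q : GenTerm (nerveSig T) A)
      (h : p.eval (nerveAlg T (T A).obj) (T A).ι ≤ q.eval (nerveAlg T (T A).obj) (T A).ι) :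
      p.eval B.obj b ≤ q.eval B.obj b := by
    refine OrdAlg.Satisfies.eval_le B.property p q (fun c X x => ?_) b
    have hx := (nerveMap T ((T A).desc fun a => x (c a))).toOrderHom.monotone h
    have hx' (r : GenTerm (nerveSig T) A) :
        (nerveMap T ((T A).desc fun a => x (c a))).toOrderHom
          (r.eval (nerveAlg T (T A).obj) (T A).ι) = (r.toOrdTerm c).eval (nerveAlg T X) x :=
      (OrdAlg.Hom.map_genEval _ _ r).trans <| Eq.trans
        (congrArg (fun a => r.eval (nerveAlg T X) a) (funext fun a => (T A).ι_desc _ a))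
        (r.eval_toOrdTerm _ x c).symm
    exact (hx' p).symm.trans_le (le_trans hx (hx' q).le)
  have hle (s : G ⟶ (T A).obj) (p : GenTerm (nerveSig T) A)
      (h : p.eval (nerveAlg T (T A).obj) (T A).ι = s) : (t s).eval B.obj b = p.eval B.obj b :=
    le_antisymm (key _ _ ((ht s).trans h.symm).le) (key _ _ (h.trans (ht s).symm).le)
  refine ⟨⟨⟨fun s => (t s).eval B.obj b, fun s s' h =>
    key _ _ ((ht s).trans_le (le_trans h (ht s').ge))⟩, fun σ x => ?_⟩, fun a => ?_⟩
  · refine hle _ (.app σ fun i => t (x i)) ?_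
    exact congrArg ((nerveAlg T (T A).obj).op σ) (funext fun i => ht (x i))
  · exact hle _ (.var a) rfl

/-- An algebra `B` in the variety is the quotient of the free algebra on its elements by the
preorder induced from `B`. That preorder is generated by a reflexive pair between copowers of `G`,
and the coinserter of the pair is an object whose algebra is `B`. -/
lemma nerve_essSurj (hcoins : HasReflexiveCoinserters C) (hfin : IsAbstractlyFinite G)
    (hproj : IsSubeffectiveProjective G) : (nerve T).EssSurj where
  mem_essImage B := by
    obtain ⟨φ, hφ⟩ := exists_hom_of_copower T hfin B (id : B.obj.carrier → B.obj.carrier)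
    let F : C := (T B.obj.carrier).obj
    let R : Type v := {p : (G ⟶ F) × (G ⟶ F) // φ.toOrderHom p.1 ≤ φ.toOrderHom p.2}
    let r₀ : (T R).obj ⟶ F := (T R).desc fun p => p.1.1
    let r₁ : (T R).obj ⟶ F := (T R).desc fun p => p.1.2
    have hr : IsReflexivePair r₀ r₁ := by
      refine ⟨(T _).desc fun b => (T R).ι ⟨((T _).ι b, (T _).ι b), le_rfl⟩, ?_, ?_⟩ <;>
      · refine (T _).copower_hom_ext fun b => ?_
        rw [← Category.assoc, Tensor.ι_desc, Tensor.ι_desc, Category.comp_id]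
    obtain ⟨X, q, hq⟩ := hcoins r₀ r₁ hr
    have hr' (s : G ⟶ (T R).obj) : φ.toOrderHom (s ≫ r₀) ≤ φ.toOrderHom (s ≫ r₁) := by
      obtain ⟨t, rfl⟩ := hfin.exists_genTerm T s
      have h₀ := OrdAlg.Hom.map_genEval (nerveMap T r₀ ≫ φ) (T R).ι t
      have h₁ := OrdAlg.Hom.map_genEval (nerveMap T r₁ ≫ φ) (T R).ι t
      refine h₀.trans_le (le_trans (t.eval_mono _ fun p => ?_) h₁.ge)
      have e₀ : (T R).ι p ≫ r₀ = p.1.1 := (T R).ι_desc _ p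
      have e₁ : (T R).ι p ≫ r₁ = p.1.2 := (T R).ι_desc _ p
      exact (congrArg φ.toOrderHom e₀).trans_le (p.2.trans (congrArg φ.toOrderHom e₁).ge)
    obtain ⟨ψ, hψ⟩ := (hproj r₀ r₁ q hr hq).exists_desc (Z := PartOrd.of B.obj.carrier)
      (PartOrd.ofHom φ.toOrderHom) hr'
    have hψ' (s : G ⟶ F) : ψ (s ≫ q) = φ.toOrderHom s :=
      congrArg (fun k : PartOrd.of (G ⟶ F) ⟶ PartOrd.of B.obj.carrier => k s) hψ
    choose l hl using hproj.exists_lift hr hq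
    let ψA : nerveAlg T X ⟶ B.obj :=
      { toOrderHom := ψ.hom
        map_op := fun σ x => by
          have hx : x = fun i => (nerveMap T q).toOrderHom (l (x i)) :=
            funext fun i => (hl (x i)).symm
          rw [hx]
          refine (congrArg ψ ((nerveMap T q).map_op σ fun i => l (x i)).symm).trans ?_
          refine (hψ' _).trans ((φ.map_op σ _).trans (congrArg (B.obj.op σ) (funext fun i => ?_)))
          exact (hψ' _).symm }
    have := OrdVariety.isIso_of_surjective (A := (nerve T).obj X) (B := B)
      (ObjectProperty.homMk ψA) (fun b => ⟨(T _).ι b ≫ q, (hψ' _).trans (hφ b)⟩)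
      (fun x y h => by
        have hlx : ψ x = φ.toOrderHom (l x) := (congrArg ψ (hl x).symm).trans (hψ' _)
        have hly : ψ y = φ.toOrderHom (l y) := (congrArg ψ (hl y).symm).trans (hψ' _)
        have hxy : φ.toOrderHom (l x) ≤ φ.toOrderHom (l y) := hlx.symm.trans_le (le_trans h hly.le)
        have := comp_le_comp_left ((T R).ι ⟨(l x, l y), hxy⟩) hq.condition
        rw [← Category.assoc, ← Category.assoc, Tensor.ι_desc, Tensor.ι_desc] at this
        exact (hl x).symm.trans_le (le_trans this (hl y).le))
    exact ⟨X, ⟨asIso (ObjectProperty.homMk ψA : (nerve T).obj X ⟶ B)⟩⟩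

end Nerve

lemma exists_isEquivalent_ordVariety (hker : HasPrekernelPairs C)
    (hcoins : HasReflexiveCoinserters C) (hG : IsStrongGenerator G) (hfin : IsAbstractlyFinite G)
    (hproj : IsSubeffectiveProjective G) :
    ∃ (S : ℕ → Type v) (E : Set (OrdTerm S × OrdTerm S)), IsEquivalent C (OrdVariety S E) := by
  let T (A : Type v) : Tensor (DiscretePoset A) G :=
    (hfin.hasTensors (DiscretePoset A)).some
  have := nerve_full T hker hcoins hG hfin hproj
  have := nerve_essSurj T hcoins hfin hproj
  have : (nerve T).Faithful := ⟨fun h => le_antisymm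
    ((nerve_map_le_iff T hG _ _).1 h.le) ((nerve_map_le_iff T hG _ _).1 h.ge)⟩
  have : (nerve T).IsEquivalence := { }
  exact ⟨nerveSig T, nerveIneqs T, .of_functor (nerve T)
    (fun _ _ f g => (nerve_map_le_iff T hG f g).2) fun _ _ f g => (nerve_map_le_iff T hG f g).1⟩

end

end PosEnriched

/-! ### Quotients of ordered algebras and free algebras -/

namespace OrdAlg

variable {S : ℕ → Type v}

/-- A preorder on an ordered algebra that extends its order and is compatible with the
operations. -/
structure AdmissiblePreorder (A : OrdAlg S) where
  rel : A.carrier → A.carrier → Prop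
  of_le : ∀ {a b}, a ≤ b → rel a b
  trans : ∀ {a b c}, rel a b → rel b c → rel a c
  op : ∀ {n : ℕ} (σ : S n) {x y : Fin n → A.carrier}, (∀ i, rel (x i) (y i)) →
    rel (A.op σ x) (A.op σ y)

namespace AdmissiblePreorder

variable {A : OrdAlg S} (r : A.AdmissiblePreorder)

/-- The elements of the algebra, preordered by the given admissible preorder. -/
def Elem (_ : A.AdmissiblePreorder) : Type v := A.carrier

instance : Preorder r.Elem where
  le := r.rel
  le_refl _ := r.of_le le_rfl
  le_trans _ _ _ := r.trans

/-- The quotient of an ordered algebra by an admissible preorder: the poset reflection of that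
preorder. Operations are computed on representatives. -/
noncomputable def quotient : OrdAlg S where
  carrier := Antisymmetrization r.Elem (· ≤ ·)
  op σ x := toAntisymmetrization (α := r.Elem) (· ≤ ·)
    (A.op σ fun i => (ofAntisymmetrization (· ≤ ·) (x i) : r.Elem))
  op_mono σ _ _ h := toAntisymmetrization_le_toAntisymmetrization_iff.2
    (r.op σ fun i => ofAntisymmetrization_le_ofAntisymmetrization_iff.2 (h i))

/-- The quotient homomorphism. -/
noncomputable def proj : A ⟶ r.quotient where
  toOrderHom :=
    ⟨fun a => toAntisymmetrization (α := r.Elem) (· ≤ ·) a,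
      fun _ _ h => toAntisymmetrization_le_toAntisymmetrization_iff.2 (r.of_le h)⟩
  map_op σ _ := Quotient.sound
    ⟨r.op σ fun _ => (Quotient.mk_out (s := AntisymmRel.setoid r.Elem (· ≤ ·)) _).2,
      r.op σ fun _ => (Quotient.mk_out (s := AntisymmRel.setoid r.Elem (· ≤ ·)) _).1⟩

lemma proj_le_proj {a b : A.carrier} : r.proj.toOrderHom a ≤ r.proj.toOrderHom b ↔ r.rel a b :=
  toAntisymmetrization_le_toAntisymmetrization_iff (α := r.Elem)

lemma proj_surjective : Function.Surjective r.proj.toOrderHom := fun x =>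
  ⟨ofAntisymmetrization (α := r.Elem) (· ≤ ·) x, toAntisymmetrization_ofAntisymmetrization _ x⟩

lemma satisfies_quotient {E : Set (OrdTerm S × OrdTerm S)}
    (h : ∀ p ∈ E, ∀ a : ℕ → A.carrier, r.rel (p.1.eval A a) (p.2.eval A a)) :
    Satisfies E r.quotient := by
  intro p hp a
  choose b hb using fun i => r.proj_surjective (a i)
  obtain rfl : (fun i => r.proj.toOrderHom (b i)) = a := funext hb
  rw [← Hom.map_eval, ← Hom.map_eval, proj_le_proj]
  exact h p hp b

lemma exists_desc {B : OrdAlg S} (f : A ⟶ B)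
    (h : ∀ a b, r.rel a b → f.toOrderHom a ≤ f.toOrderHom b) :
    ∃ g : r.quotient ⟶ B, ∀ a, g.toOrderHom (r.proj.toOrderHom a) = f.toOrderHom a := by
  choose l hl using r.proj_surjective
  have hfl (a : A.carrier) : f.toOrderHom (l (r.proj.toOrderHom a)) = f.toOrderHom a :=
    le_antisymm (h _ _ (r.proj_le_proj.1 (hl _).le)) (h _ _ (r.proj_le_proj.1 (hl _).ge))
  refine ⟨⟨⟨fun x => f.toOrderHom (l x), fun x y hxy => h _ _ ?_⟩, fun σ x => ?_⟩, hfl⟩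
  · rwa [← r.proj_le_proj, hl, hl]
  · obtain ⟨y, rfl⟩ : ∃ y : Fin _ → A.carrier, (fun i => r.proj.toOrderHom (y i)) = x :=
      ⟨fun i => l (x i), funext fun i => hl _⟩
    change f.toOrderHom (l (r.quotient.op σ fun i => r.proj.toOrderHom (y i))) =
      B.op σ fun i => f.toOrderHom (l (r.proj.toOrderHom (y i)))
    rw [← Hom.map_op, hfl, Hom.map_op]
    exact congrArg (B.op σ) (funext fun i => (hfl _).symm)

end AdmissiblePreorder

/-- The algebra of terms over `P`, discretely ordered. -/
def termAlg (S : ℕ → Type v) (P : Type v) : OrdAlg S where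
  carrier := DiscretePoset (GenTerm S P)
  op σ t := GenTerm.app σ t
  op_mono σ _ _ h := congrArg (GenTerm.app σ) (funext h)

/-- The homomorphism from the algebra of terms given by evaluation. -/
def evalHom {P : Type v} (B : OrdAlg S) (b : P → B.carrier) : termAlg S P ⟶ B where
  toOrderHom := DiscretePoset.lift fun t : GenTerm S P => t.eval B b
  map_op _ _ := rfl

/-- Terms over a poset `P` are compared by their values under all monotone maps from `P` to
algebras satisfying `E`. -/
def freePreorder (E : Set (OrdTerm S × OrdTerm S)) (P : Type v) [PartialOrder P] :
    (termAlg S P).AdmissiblePreorder where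
  rel s t := ∀ B : OrdAlg S, Satisfies E B → ∀ f : P →o B.carrier,
    (evalHom B f).toOrderHom s ≤ (evalHom B f).toOrderHom t
  of_le h B _ f := (evalHom B f).toOrderHom.monotone h
  trans h h' B hB f := (h B hB f).trans (h' B hB f)
  op σ _ _ h B hB f := B.op_mono σ fun i => h i B hB f

end OrdAlg

namespace OrdVariety

open OrdAlg

variable {S : ℕ → Type v} (E : Set (OrdTerm S × OrdTerm S)) (P : Type v) [PartialOrder P]

/-- The free algebra of a variety on a poset `P`. -/
noncomputable def free : OrdVariety S E where
  obj := (freePreorder E P).quotient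
  property := (freePreorder E P).satisfies_quotient fun p hp a B hB f => by
    rw [Hom.map_eval, Hom.map_eval]
    exact hB p hp _

/-- The universal monotone map to the free algebra. -/
noncomputable def freeUnit : P →o (free E P).obj.carrier where
  toFun p := (freePreorder E P).proj.toOrderHom (GenTerm.var p)
  monotone' _ _ h := (freePreorder E P).proj_le_proj.2 fun _ _ f => f.monotone h

variable {E P}

lemma free_exists_genTerm (x : (free E P).obj.carrier) :
    ∃ t : GenTerm S P, t.eval (free E P).obj (freeUnit E P) = x := by
  obtain ⟨t, rfl⟩ := (freePreorder E P).proj_surjective x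
  refine ⟨t, ((freePreorder E P).proj.map_genEval GenTerm.var t).symm.trans ?_⟩
  refine congrArg (freePreorder E P).proj.toOrderHom ?_
  induction t with
  | var p => rfl
  | app σ t ih => exact congrArg (GenTerm.app σ) (funext ih)

lemma exists_freeLift {B : OrdVariety S E} (f : P →o B.obj.carrier) :
    ∃ g : free E P ⟶ B, ∀ p, g.hom.toOrderHom (freeUnit E P p) = f p := by
  obtain ⟨g, hg⟩ := (freePreorder E P).exists_desc (evalHom B.obj f)
    fun s t h => h B.obj B.property f
  exact ⟨ObjectProperty.homMk g, fun p => hg _⟩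

end OrdVariety

namespace PosEnriched

/-! ### Free objects in a category equivalent to a variety -/

section

variable {C : Type u} [Category.{v} C] {S : ℕ → Type v} {E : Set (OrdTerm S × OrdTerm S)}
  (Φ : C ⥤ OrdVariety S E)

/-- The action of a morphism on elements of the corresponding algebras. -/
abbrev elemMap {X Y : C} (f : X ⟶ Y) : (Φ.obj X).obj.carrier →o (Φ.obj Y).obj.carrier :=
  (Φ.map f).hom.toOrderHom

lemma elemMap_comp {X Y Z : C} (f : X ⟶ Y) (g : Y ⟶ Z) (x : (Φ.obj X).obj.carrier) :
    elemMap Φ (f ≫ g) x = elemMap Φ g (elemMap Φ f x) := by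
  rw [elemMap, Φ.map_comp]
  rfl

lemma elemMap_id {X : C} (x : (Φ.obj X).obj.carrier) : elemMap Φ (𝟙 X) x = x := by
  rw [elemMap, Φ.map_id]
  rfl

variable [PosEnriched C]

/-- A free object on a poset `P` with respect to the underlying poset functor of `Φ`. Besides the
enriched universal property, its algebra is required to be generated by `P`. -/
structure FreeOn (P : Type v) [PartialOrder P] where
  obj : C
  unit : P →o (Φ.obj obj).obj.carrier
  exists_lift : ∀ {X : C} (f : P →o (Φ.obj X).obj.carrier),
    ∃ g : obj ⟶ X, ∀ p, elemMap Φ g (unit p) = f p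
  hom_le : ∀ {X : C} {g g' : obj ⟶ X},
    (∀ p, elemMap Φ g (unit p) ≤ elemMap Φ g' (unit p)) → g ≤ g'
  exists_genTerm : ∀ x : (Φ.obj obj).obj.carrier,
    ∃ t : GenTerm S P, t.eval (Φ.obj obj).obj unit = x

lemma nonempty_freeOn [Φ.IsEquivalence]
    (hΦ : ∀ ⦃X Y : C⦄ (f g : X ⟶ Y), Φ.map f ≤ Φ.map g ↔ f ≤ g)
    (P : Type v) [PartialOrder P] : Nonempty (FreeOn Φ P) := by
  let i := Φ.objObjPreimageIso (OrdVariety.free E P)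
  let η : P →o (Φ.obj (Φ.objPreimage (OrdVariety.free E P))).obj.carrier :=
    i.inv.hom.toOrderHom.comp (OrdVariety.freeUnit E P)
  have hgen (x : (Φ.obj (Φ.objPreimage (OrdVariety.free E P))).obj.carrier) :
      ∃ t : GenTerm S P, t.eval _ η = x := by
    obtain ⟨t, ht⟩ := OrdVariety.free_exists_genTerm (i.hom.hom.toOrderHom x)
    refine ⟨t, (i.inv.hom.map_genEval _ t).symm.trans ((congrArg _ ht).trans ?_)⟩
    exact congrArg (fun k : Φ.obj _ ⟶ Φ.obj _ => k.hom.toOrderHom x) i.hom_inv_id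
  refine ⟨⟨_, η, fun {X} f => ?_, fun {X g g'} h => (hΦ _ _).1 fun x => ?_, hgen⟩⟩
  · obtain ⟨g, hg⟩ := OrdVariety.exists_freeLift (B := Φ.obj X) f
    refine ⟨Φ.preimage (i.hom ≫ g), fun p => ?_⟩
    rw [elemMap, Φ.map_preimage]
    refine Eq.trans (congrArg g.hom.toOrderHom ?_) (hg p)
    exact congrArg (fun k : OrdVariety.free E P ⟶ OrdVariety.free E P =>
      k.hom.toOrderHom (OrdVariety.freeUnit E P p)) i.inv_hom_id
  · obtain ⟨t, rfl⟩ := hgen x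
    exact ((Φ.map g).hom.map_genEval η t).trans_le
      ((t.eval_mono _ h).trans ((Φ.map g').hom.map_genEval η t).ge)

variable {Φ}

namespace FreeOn

variable {P : Type v} [PartialOrder P] (F : FreeOn Φ P)

/-- The morphism given by the universal property. -/
noncomputable def lift {X : C} (f : P →o (Φ.obj X).obj.carrier) : F.obj ⟶ X :=
  (F.exists_lift f).choose

lemma lift_unit {X : C} (f : P →o (Φ.obj X).obj.carrier) (p : P) :
    elemMap Φ (F.lift f) (F.unit p) = f p :=
  (F.exists_lift f).choose_spec p

lemma hom_ext {X : C} {g g' : F.obj ⟶ X}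
    (h : ∀ p, elemMap Φ g (F.unit p) = elemMap Φ g' (F.unit p)) : g = g' :=
  le_antisymm (F.hom_le fun p => (h p).le) (F.hom_le fun p => (h p).ge)

variable (G : FreeOn Φ PUnit.{v + 1})

/-- The element classified by a morphism from the free object on one generator. -/
def elem {X : C} (g : G.obj ⟶ X) : (Φ.obj X).obj.carrier := elemMap Φ g (G.unit ⟨⟩)

/-- The morphism from the free object on one generator classifying an element. -/
noncomputable def ofElem {X : C} (x : (Φ.obj X).obj.carrier) : G.obj ⟶ X :=
  G.lift (OrderHom.const _ x)

lemma elem_ofElem {X : C} (x : (Φ.obj X).obj.carrier) : G.elem (G.ofElem x) = x :=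
  G.lift_unit _ _

lemma elem_comp {X Y : C} (g : G.obj ⟶ X) (h : X ⟶ Y) :
    G.elem (g ≫ h) = elemMap Φ h (G.elem g) :=
  elemMap_comp Φ g h _

lemma le_of_elem_le {X : C} {g g' : G.obj ⟶ X} (h : G.elem g ≤ G.elem g') : g ≤ g' :=
  G.hom_le fun _ => h

lemma elem_injective {X : C} : Function.Injective (G.elem (X := X)) := fun _ _ h =>
  le_antisymm (G.le_of_elem_le h.le) (G.le_of_elem_le h.ge)

lemma ofElem_elem {X : C} (g : G.obj ⟶ X) : G.ofElem (G.elem g) = g :=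
  G.elem_injective (G.elem_ofElem _)

lemma ofElem_mono {X : C} : Monotone (G.ofElem (X := X)) := fun x y h =>
  G.le_of_elem_le (by rwa [elem_ofElem, elem_ofElem])

lemma ofElem_comp {X Y : C} (x : (Φ.obj X).obj.carrier) (h : X ⟶ Y) :
    G.ofElem x ≫ h = G.ofElem (elemMap Φ h x) :=
  G.elem_injective (by rw [elem_comp, elem_ofElem, elem_ofElem])

variable (hΦ : ∀ ⦃X Y : C⦄ (f g : X ⟶ Y), Φ.map f ≤ Φ.map g ↔ f ≤ g)

include hΦ in
lemma elem_mono {X : C} : Monotone (G.elem (X := X)) := fun _ _ h =>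
  (hΦ _ _).2 h _

/-- The monotone family of elements classified by a monotone family of morphisms. -/
def elemHom {X : C} (f : P →o (G.obj ⟶ X)) : P →o (Φ.obj X).obj.carrier :=
  ⟨fun p => G.elem (f p), fun _ _ h => G.elem_mono hΦ (f.monotone h)⟩

/-- The free object on `P` is the tensor by `P` of the free object on one generator. -/
noncomputable def tensor : Tensor P G.obj where
  obj := F.obj
  homIso X :=
    { toFun := fun f => F.lift (G.elemHom hΦ f)
      invFun := fun g => ⟨fun p => G.ofElem (elemMap Φ g (F.unit p)),
        fun _ _ h => G.ofElem_mono ((elemMap Φ g).monotone (F.unit.monotone h))⟩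
      left_inv := fun f => OrderHom.ext _ _ (funext fun p =>
        (congrArg G.ofElem (F.lift_unit _ p)).trans (G.ofElem_elem (f p)))
      right_inv := fun g => F.hom_ext fun p => (F.lift_unit _ p).trans (G.elem_ofElem _)
      map_rel_iff' := by
        intro f f'
        constructor
        · intro h p
          refine G.le_of_elem_le ?_
          have := (hΦ _ _).2 h (F.unit p)
          exact (F.lift_unit _ p).symm.trans_le (le_trans this (F.lift_unit _ p).le)
        · intro h
          refine F.hom_le fun p => ?_
          exact (F.lift_unit _ p).trans_le
            (le_trans (G.elem_mono hΦ (h p)) (F.lift_unit (G.elemHom hΦ f') p).ge) }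
  naturality f h := F.hom_ext fun p => (F.lift_unit _ p).trans <| (G.elem_comp _ h).trans <|
    ((elemMap_comp Φ _ h _).trans
      (congrArg (elemMap Φ h) (F.lift_unit (G.elemHom hΦ f) p))).symm

lemma elem_tensor_unit (p : P) : G.elem ((F.tensor G hΦ).unit p) = F.unit p :=
  (G.elem_ofElem _).trans (elemMap_id Φ _)

include F hΦ in
/-- The algebra of any tensor by `P` is generated by `P`. -/
lemma exists_genTerm_tensor (T : Tensor P G.obj) (x : (Φ.obj T.obj).obj.carrier) :
    ∃ t : GenTerm S P, t.eval (Φ.obj T.obj).obj (fun p => G.elem (T.unit p)) = x := by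
  let c : T.obj ⟶ F.obj := T.map (F.tensor G hΦ) OrderHom.id
  let d : F.obj ⟶ T.obj := (F.tensor G hΦ).map T OrderHom.id
  have hcd : c ≫ d = 𝟙 _ := (T.map_comp_map _ _ _ _).trans T.map_id
  obtain ⟨t, ht⟩ := F.exists_genTerm (elemMap Φ c x)
  have hd : elemMap Φ d (elemMap Φ c x) = x := by rw [← elemMap_comp, hcd, elemMap_id]
  refine ⟨t, Eq.trans ?_ hd⟩
  rw [← ht]
  refine Eq.trans ?_ ((Φ.map d).hom.map_genEval F.unit t).symm
  refine congrArg (fun a => t.eval (Φ.obj T.obj).obj a) (funext fun p => ?_)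
  have h := (F.tensor G hΦ).unit_map T OrderHom.id p
  rw [← elem_tensor_unit F G hΦ]
  exact (congrArg G.elem h).symm.trans (G.elem_comp _ d)

include hΦ in
lemma isAbstractlyFinite (hF : ∀ (P : Type v) [PartialOrder P], Nonempty (FreeOn Φ P)) :
    IsAbstractlyFinite G.obj where
  hasTensors P _ := ⟨(hF P).some.tensor G hΦ⟩
  exists_factor P _ T f := by
    obtain ⟨t, ht⟩ := (hF P).some.exists_genTerm_tensor G hΦ T (G.elem f)
    obtain ⟨t', ht'⟩ := t.exists_restrict subset_rfl
    let T' : Tensor t.vars G.obj := (hF t.vars).some.tensor G hΦ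
    refine ⟨t.vars, t.finite_vars, T',
      G.ofElem (t'.eval (Φ.obj T'.obj).obj fun q => G.elem (T'.unit q)), G.elem_injective ?_⟩
    rw [elem_comp, elem_ofElem, ← ht, ← ht']
    refine ((Φ.map _).hom.map_genEval _ t').trans ?_
    refine congrArg (fun a => t'.eval (Φ.obj T.obj).obj a) (funext fun q => ?_)
    exact (G.elem_comp _ _).symm.trans (congrArg G.elem (T'.unit_map T _ q))

include hΦ in
lemma isStrongGenerator [Φ.IsEquivalence]
    (hF : ∀ (P : Type v) [PartialOrder P], Nonempty (FreeOn Φ P)) :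
    IsStrongGenerator G.obj where
  hasCopowers A := ⟨⟨⟨_, ((hF (DiscretePoset A)).some.tensor G hΦ).isColimitCofan⟩⟩⟩
  exists_quotient X := by
    let A : Type v := (Φ.obj X).obj.carrier
    let T : Tensor (DiscretePoset A) G.obj := (hF (DiscretePoset A)).some.tensor G hΦ
    let e : T.obj ⟶ X := T.desc fun x : A => G.ofElem x
    have he (x : A) : elemMap Φ e (G.elem (T.ι x)) = x := by
      rw [← elem_comp, T.ι_desc, elem_ofElem]
    refine ⟨A, Cofan.mk T.obj T.ι, e, ⟨T.isColimitCofan⟩,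
      fun Z w₀ w₁ h => (hΦ _ _).1 fun x => ?_, fun Z p m hm hpm => ?_⟩
    · have := (hΦ _ _).2 h (G.elem (T.ι x))
      have h₀ := (elemMap_comp Φ e w₀ _).trans (congrArg (elemMap Φ w₀) (he x))
      have h₁ := (elemMap_comp Φ e w₁ _).trans (congrArg (elemMap Φ w₁) (he x))
      exact h₀.symm.trans_le (le_trans this h₁.le)
    · have : IsIso (Φ.map m) := OrdVariety.isIso_of_surjective _
        (fun x => ⟨elemMap Φ p (G.elem (T.ι x)), by
          refine (elemMap_comp Φ p m _).symm.trans ?_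
          rw [hpm]
          exact he x⟩)
        (fun y y' h => by
          have h' : G.ofElem y ≤ G.ofElem y' := hm _ _ (by
            rw [ofElem_comp, ofElem_comp]
            exact G.ofElem_mono h)
          have := G.elem_mono hΦ h'
          rwa [elem_ofElem, elem_ofElem] at this)
      exact isIso_of_reflects_iso m Φ

end FreeOn

end

end PosEnriched

/-! ### Reflexive coinserters in varieties -/

namespace OrdAlg

variable {S : ℕ → Type v} {A X : OrdAlg S}

/-- One step of the preorder on `X` generated by a pair of homomorphisms. -/
def CoinserterStep (u₀ u₁ : A ⟶ X) (x y : X.carrier) : Prop :=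
  ∃ a, x ≤ u₀.toOrderHom a ∧ u₁.toOrderHom a ≤ y

/-- The preorder generated by a reflexive pair of homomorphisms is admissible: reflexivity allows
the arguments of an operation to be changed one at a time. -/
def coinserterPreorder (u₀ u₁ : A ⟶ X) (h : IsReflexivePair u₀ u₁) : X.AdmissiblePreorder where
  rel := Relation.ReflTransGen (CoinserterStep u₀ u₁)
  of_le {x y} hxy := by
    obtain ⟨d, h₀, h₁⟩ := h
    refine .single ⟨d.toOrderHom x, ?_, ?_⟩
    · exact (congrArg (fun k : X ⟶ X => k.toOrderHom x) h₀).ge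
    · exact (congrArg (fun k : X ⟶ X => k.toOrderHom x) h₁).trans_le hxy
  trans := Relation.ReflTransGen.trans
  op {n} σ x y hxy := by
    classical
    obtain ⟨d, h₀, h₁⟩ := h
    have h₀' (z : X.carrier) : u₀.toOrderHom (d.toOrderHom z) = z :=
      congrArg (fun k : X ⟶ X => k.toOrderHom z) h₀
    have h₁' (z : X.carrier) : u₁.toOrderHom (d.toOrderHom z) = z :=
      congrArg (fun k : X ⟶ X => k.toOrderHom z) h₁
    have step (z : Fin n → X.carrier) (i : Fin n) (b b' : X.carrier)
        (hb : CoinserterStep u₀ u₁ b b') : CoinserterStep u₀ u₁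
          (X.op σ (Function.update z i b)) (X.op σ (Function.update z i b')) := by
      obtain ⟨a, ha₀, ha₁⟩ := hb
      refine ⟨A.op σ (Function.update (fun j => d.toOrderHom (z j)) i a), ?_, ?_⟩
      · rw [u₀.map_op]
        refine X.op_mono σ fun j => ?_
        rcases eq_or_ne j i with rfl | hj
        · simpa using ha₀
        · simp [hj, h₀']
      · rw [u₁.map_op]
        refine X.op_mono σ fun j => ?_
        rcases eq_or_ne j i with rfl | hj
        · simpa using ha₁
        · simp [hj, h₁']
    have key (s : Finset (Fin n)) : Relation.ReflTransGen (CoinserterStep u₀ u₁) (X.op σ x)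
        (X.op σ (s.piecewise y x)) := by
      induction s using Finset.induction_on with
      | empty => rw [Finset.piecewise_empty]
      | insert i s hi ih =>
        refine ih.trans ?_
        have h := (hxy i).lift (fun b => X.op σ (Function.update (s.piecewise y x) i b))
          (step (s.piecewise y x) i)
        have hz : Function.update (s.piecewise y x) i (x i) = s.piecewise y x := by
          rw [← Finset.piecewise_eq_of_notMem s y x hi, Function.update_eq_self]
        rw [Finset.piecewise_insert]
        exact (congrArg (X.op σ) hz) ▸ h
    simpa using key Finset.univ

end OrdAlg

namespace PosEnriched

section

variable {C : Type u} [Category.{v} C] [PosEnriched C] {S : ℕ → Type v}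
  {E : Set (OrdTerm S × OrdTerm S)} (Φ : C ⥤ OrdVariety S E) [Φ.IsEquivalence]
  (hΦ : ∀ ⦃X Y : C⦄ (f g : X ⟶ Y), Φ.map f ≤ Φ.map g ↔ f ≤ g)

include hΦ in
/-- Reflexive coinserters in a variety are computed on underlying posets: the quotient by the
preorder generated by the pair is again an algebra of the variety. -/
lemma IsCoinserter.surjective_and_reflTransGen {U X Y : C} {u₀ u₁ : U ⟶ X} {f : X ⟶ Y}
    (hu : IsReflexivePair u₀ u₁) (hf : IsCoinserter u₀ u₁ f) :
    Function.Surjective (elemMap Φ f) ∧ ∀ x y, elemMap Φ f x ≤ elemMap Φ f y →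
      Relation.ReflTransGen (OrdAlg.CoinserterStep (Φ.map u₀).hom (Φ.map u₁).hom) x y := by
  have hu' : IsReflexivePair (Φ.map u₀).hom (Φ.map u₁).hom := by
    obtain ⟨d, h₀, h₁⟩ := hu
    refine ⟨(Φ.map d).hom, ?_, ?_⟩
    · exact congrArg (fun k => k.hom) ((Φ.map_comp d u₀).symm.trans
        ((congrArg Φ.map h₀).trans (Φ.map_id X)))
    · exact congrArg (fun k => k.hom) ((Φ.map_comp d u₁).symm.trans
        ((congrArg Φ.map h₁).trans (Φ.map_id X)))
  let r := OrdAlg.coinserterPreorder (Φ.map u₀).hom (Φ.map u₁).hom hu'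
  let Z : OrdVariety S E := ⟨r.quotient, r.satisfies_quotient fun p hp a =>
    r.of_le ((Φ.obj X).property p hp a)⟩
  let i := Φ.objObjPreimageIso Z
  let π : Φ.obj X ⟶ Z := ObjectProperty.homMk r.proj
  let q : X ⟶ Φ.objPreimage Z := Φ.preimage (π ≫ i.inv)
  have hq (x) : elemMap Φ q x = i.inv.hom.toOrderHom (r.proj.toOrderHom x) := by
    rw [elemMap, Φ.map_preimage]
    rfl
  have hi (z) : i.hom.hom.toOrderHom (i.inv.hom.toOrderHom z) = z :=
    congrArg (fun k : Z ⟶ Z => k.hom.toOrderHom z) i.inv_hom_id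
  have hi' (z) : i.inv.hom.toOrderHom (i.hom.hom.toOrderHom z) = z :=
    congrArg (fun k : Φ.obj _ ⟶ Φ.obj _ => k.hom.toOrderHom z) i.hom_inv_id
  obtain ⟨g, hg⟩ := hf.exists_desc q ((hΦ _ _).1 fun a => by
    refine (elemMap_comp Φ u₀ q a).trans_le (le_trans ?_ (elemMap_comp Φ u₁ q a).ge)
    rw [hq, hq]
    exact i.inv.hom.toOrderHom.monotone (r.proj_le_proj.2 (.single ⟨a, le_rfl, le_rfl⟩)))
  obtain ⟨h, hh⟩ := r.exists_desc (Φ.map f).hom (fun x y hxy => by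
    induction hxy with
    | refl => exact le_rfl
    | tail _ hs ih =>
      obtain ⟨a, h₀, h₁⟩ := hs
      refine ih.trans (((elemMap Φ f).monotone h₀).trans
        (le_trans ?_ ((elemMap Φ f).monotone h₁)))
      have := (hΦ _ _).2 hf.condition a
      exact (elemMap_comp Φ u₀ f a).symm.trans_le (le_trans this (elemMap_comp Φ u₁ f a).le))
  let k : Φ.objPreimage Z ⟶ Y := Φ.preimage (i.hom ≫ ObjectProperty.homMk h)
  have hk (z) : elemMap Φ k z = h.toOrderHom (i.hom.hom.toOrderHom z) := by
    rw [elemMap, Φ.map_preimage]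
    rfl
  have hqk (x) : elemMap Φ k (elemMap Φ q x) = elemMap Φ f x := by
    rw [hk, hq, hi]
    exact hh x
  have hfgk : f ≫ g ≫ k = f ≫ 𝟙 Y := by
    rw [← Category.assoc, hg, Category.comp_id]
    refine le_antisymm ((hΦ _ _).1 fun x => ?_) ((hΦ _ _).1 fun x => ?_)
    · exact ((elemMap_comp Φ q k x).trans (hqk x)).le
    · exact ((elemMap_comp Φ q k x).trans (hqk x)).ge
  have hgk : g ≫ k = 𝟙 Y :=
    le_antisymm (hf.le_of_comp_le _ _ hfgk.le) (hf.le_of_comp_le _ _ hfgk.ge)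
  refine ⟨fun y => ?_, fun x y hxy => ?_⟩
  · obtain ⟨x, hx⟩ := r.proj_surjective (i.hom.hom.toOrderHom (elemMap Φ g y))
    refine ⟨x, ?_⟩
    rw [← hqk, hq, hx, hi', ← elemMap_comp, hgk, elemMap_id]
  · have hqxy : elemMap Φ q x ≤ elemMap Φ q y := by
      rw [← hg, elemMap_comp, elemMap_comp]
      exact (elemMap Φ g).monotone hxy
    rw [hq, hq] at hqxy
    have := i.hom.hom.toOrderHom.monotone hqxy
    rw [hi, hi] at this
    exact r.proj_le_proj.1 this

variable {Φ}

include hΦ in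
/-- The hom-functor of the free object on one generator is the underlying poset functor, so it
preserves reflexive coinserters. -/
lemma FreeOn.isSubeffectiveProjective (G : FreeOn Φ PUnit.{v + 1}) : IsSubeffectiveProjective G.obj := by
  intro U X Y u₀ u₁ f hu hf
  obtain ⟨hs, hr⟩ := hf.surjective_and_reflTransGen Φ hΦ hu
  have hs' (y : G.obj ⟶ Y) : ∃ x : G.obj ⟶ X, x ≫ f = y := by
    obtain ⟨x, hx⟩ := hs (G.elem y)
    exact ⟨G.ofElem x, by rw [ofElem_comp, hx, ofElem_elem]⟩
  refine ⟨fun x => ?_, fun W f' hf' => ?_, fun W g g' h y => ?_⟩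
  · change (x ≫ u₀) ≫ f ≤ (x ≫ u₁) ≫ f
    exact (Category.assoc (W := G.obj) x u₀ f).trans_le (le_trans
      (comp_le_comp_left (X := G.obj) x hf.condition) (Category.assoc (W := G.obj) x u₁ f).ge)
  · have hmono (x x' : G.obj ⟶ X) (h : x ≫ f ≤ x' ≫ f) : f' x ≤ f' x' := by
      have h' := G.elem_mono hΦ h
      rw [elem_comp, elem_comp] at h'
      have key (a b) (hab : Relation.ReflTransGen
          (OrdAlg.CoinserterStep (Φ.map u₀).hom (Φ.map u₁).hom) a b) :
          f' (G.ofElem a) ≤ f' (G.ofElem b) := by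
        induction hab with
        | refl => exact le_rfl
        | tail _ hs ih =>
          obtain ⟨c, h₀, h₁⟩ := hs
          refine ih.trans ((f'.hom.monotone (G.ofElem_mono h₀)).trans
            (le_trans ?_ (f'.hom.monotone (G.ofElem_mono h₁))))
          have hc : f' (G.ofElem c ≫ u₀) ≤ f' (G.ofElem c ≫ u₁) := hf' (G.ofElem c)
          rwa [ofElem_comp, ofElem_comp] at hc
      have := key _ _ (hr _ _ h')
      rwa [ofElem_elem, ofElem_elem] at this
    choose l hl using hs'
    refine ⟨PartOrd.ofHom ⟨fun y => f' (l y), fun y y' h => hmono _ _ ?_⟩, ?_⟩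
    · exact (hl y).trans_le (le_trans h (hl y').ge)
    · ext x
      exact le_antisymm (hmono _ _ (hl _).le) (hmono _ _ (hl _).ge)
  · obtain ⟨x, rfl⟩ := hs' y
    exact h x

end

end PosEnriched

theorem theorem4p7 {K : Type u} [Category.{v} K] [PosEnriched K]
    (hker : PosEnriched.HasPrekernelPairs K) (hcoins : PosEnriched.HasReflexiveCoinserters K) :
    (∃ (S : ℕ → Type v) (E : Set (OrdTerm S × OrdTerm S)),
        PosEnriched.IsEquivalent K (OrdVariety S E)) ↔
      ∃ G : K, PosEnriched.IsStrongGenerator G ∧ PosEnriched.IsAbstractlyFinite G ∧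
        PosEnriched.IsSubeffectiveProjective G := by
  constructor
  · rintro ⟨S, E, e, he, he'⟩
    have hΦ ⦃X Y : K⦄ (f g : X ⟶ Y) : e.functor.map f ≤ e.functor.map g ↔ f ≤ g :=
      ⟨he'.le_of_map_le, he f g⟩
    have hF (P : Type v) [PartialOrder P] := PosEnriched.nonempty_freeOn e.functor hΦ P
    obtain ⟨G⟩ := hF PUnit
    exact ⟨G.obj, G.isStrongGenerator hΦ hF, G.isAbstractlyFinite hΦ hF,
      G.isSubeffectiveProjective hΦ⟩
  · rintro ⟨G, hG, hfin, hproj⟩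
    exact PosEnriched.exists_isEquivalent_ordVariety hker hcoins hG hfin hproj
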